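/- Let $V$ be a finite set of points in the Euclidean plane. A double-normal pair of $V$ is a pair $\{p,q\}$ of distinct points of $V$ such that $V$ lies in the closed strip bounded by the two lines through $p$ and through $q$ that are perpendicular to the segment $pq$. Let $N(V)$ denote the number of double-normal pairs of $V$. If $|V|\ge 3$, then $$N(V)\le 3\left\lfloor \frac{|V|}{2}\right\rfloor .$$ This bound is attained for every size: for every integer $n\ge 3$ there is a set $V$ of $n$ points in the plane with $N(V)=3\lfloor n/2\rfloor$. Moreover, if $|V|\geq 3$ is even and $N(V)=3|V|/2$, then $V$ lies on a circle and is symmetric with respect to the centre of that circle. -/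

import Mathlib

/-- The closed strip bounded by the hyperplanes through `p` and `q` that are perpendicular
to the segment `pq` (for `p ≠ q`): it is the intersection of the closed half-space bounded by
the hyperplane through `p` that contains `q` with the closed half-space bounded by the
hyperplane through `q` that contains `p`. -/
def closedStrip {E : Type*} [NormedAddCommGroup E] [InnerProductSpace ℝ E] (p q : E) : Set E :=
  {x | 0 ≤ inner ℝ (x - p) (q - p) ∧ 0 ≤ inner ℝ (x - q) (p - q)}

/-- The double-normal graph of a finite set `V` of points: its vertices are the points of `V`,
and two distinct points `p`, `q` of `V` are adjacent if and only if `{p, q}` is a double-normal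
pair of `V`, that is, `V` lies in the closed strip determined by `p` and `q`. -/
def doubleNormalGraph {E : Type*} [NormedAddCommGroup E] [InnerProductSpace ℝ E]
    (V : Finset E) : SimpleGraph V where
  Adj p q := p ≠ q ∧ (V : Set E) ⊆ closedStrip (p : E) (q : E)
  symm := ⟨fun _ _ h => ⟨h.1.symm, fun _ hx => ⟨(h.2 hx).2, (h.2 hx).1⟩⟩⟩
  loopless := ⟨fun _ h => h.1 rfl⟩

/-- The number `N(V)` of double-normal pairs of `V`: the number of edges of its
double-normal graph. -/
noncomputable def numDoubleNormals {E : Type*} [NormedAddCommGroup E] [InnerProductSpace ℝ E]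
    (V : Finset E) : ℕ :=
  (doubleNormalGraph V).edgeSet.ncard

/-! At a point `p` any two double normals form a non-obtuse angle, so one of them is leftmost. Call
a double normal residual if it is leftmost at neither end. If `pq` is residual, the leftmost double
normals at `p` and `q` leave on opposite sides of `pq`; the resulting quadrilateral has no obtuse
angle, hence is a rectangle (`rectangle_of_angles`, `IsResidual.rectangle`). This rigidity makes
residual double normals a matching (`IsResidual.unique`) and `leftNbr` injective on matched points.
Counting at most one leftmost double normal per point plus a matching gives `2N ≤ 3|V|`
(`card_pairs_add_le`), which settles even `|V|`.

If `2N = 3|V|`, every point is matched and no double normal is leftmost at both ends. Then `leftNbr`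
permutes `V` and commutes with `partner`, so the rectangle on a residual double normal generates
further rectangles with the same centre. Their sides bound a polygon inscribed in a circle, with `V`
to the left of every side. Starting from a shortest residual double normal forces all of `V` onto
this circle (`IsExtremal.exists_circle`).

For odd `|V|`, a count above the bound leaves exactly one unmatched point. It lies on only one
double normal, and deleting it leaves an extremal set. The point is then strictly inside the circle
of that set, where it cannot be an end of a double normal.

Equality is attained by regular `2m`-gons, with the centre added for odd sizes at least 5, and by a
right triangle for size 3. -/

abbrev Plane := EuclideanSpace ℝ (Fin 2)

/-! ### Coordinates in the plane. -/

namespace Plane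

def cross (x y : Plane) : ℝ := x 0 * y 1 - x 1 * y 0

lemma inner_eq (x y : Plane) : inner ℝ x y = x 0 * y 0 + x 1 * y 1 := by
  simp [PiLp.inner_apply, Fin.sum_univ_two, mul_comm]

lemma ext_coord {x y : Plane} (h0 : x 0 = y 0) (h1 : x 1 = y 1) : x = y := by
  ext i; fin_cases i <;> assumption

lemma dist_sq (x y : Plane) : dist x y ^ 2 = (x 0 - y 0) ^ 2 + (x 1 - y 1) ^ 2 := by
  rw [EuclideanSpace.dist_eq, Real.sq_sqrt (by positivity), Fin.sum_univ_two]
  simp [Real.dist_eq, sq_abs]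

lemma ne_iff_sq_pos {x y : Plane} : x ≠ y ↔ 0 < (x 0 - y 0) ^ 2 + (x 1 - y 1) ^ 2 := by
  rw [← dist_sq]
  constructor
  · intro h
    have := dist_pos.2 h
    positivity
  · rintro h rfl
    simp at h

lemma mem_closedStrip {p q x : Plane} : x ∈ closedStrip p q ↔
    0 ≤ (x 0 - p 0) * (q 0 - p 0) + (x 1 - p 1) * (q 1 - p 1) ∧
      0 ≤ (x 0 - q 0) * (p 0 - q 0) + (x 1 - q 1) * (p 1 - q 1) := by
  simp [closedStrip, inner_eq]

lemma cross_sub (p x y : Plane) :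
    cross (x - p) (y - p) = (x 0 - p 0) * (y 1 - p 1) - (x 1 - p 1) * (y 0 - p 0) := by
  simp [cross]

end Plane

open Plane

/-! ### Non-obtuse angles and rectangles. -/

/-- A quadrilateral with no obtuse angle is a rectangle: here `a`, `b` and `c` are the
vectors from one vertex to the two adjacent ones and to the opposite one. -/
lemma rectangle_of_angles {a₁ a₂ b₁ b₂ c₁ c₂ : ℝ} (h1 : 0 ≤ a₁ * b₁ + a₂ * b₂)
    (h2 : 0 ≤ a₁ * (a₁ - c₁) + a₂ * (a₂ - c₂))
    (h3 : 0 ≤ (c₁ - a₁) * (c₁ - b₁) + (c₂ - a₂) * (c₂ - b₂))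
    (h4 : 0 ≤ b₁ * (b₁ - c₁) + b₂ * (b₂ - c₂))
    (h5 : 0 ≤ a₁ * c₁ + a₂ * c₂)
    (h6 : 0 ≤ c₁ * (c₁ - b₁) + c₂ * (c₂ - b₂))
    (hx : (c₁ * a₂ - c₂ * a₁) * (c₁ * b₂ - c₂ * b₁) < 0) :
    a₁ + b₁ = c₁ ∧ a₂ + b₂ = c₂ ∧ a₁ * b₁ + a₂ * b₂ = 0 := by
  have hL : 0 < c₁ ^ 2 + c₂ ^ 2 := by
    rcases eq_or_ne c₁ 0 with h | h
    · rcases eq_or_ne c₂ 0 with h' | h'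
      · simp [h, h'] at hx
      · positivity
    · positivity
  -- Up to scaling, `(x, y)` and `(u, v)` are the coordinates of `a` and `b` along and across the
  -- diagonal `c`.
  obtain ⟨L, hLd⟩ : ∃ L, L = c₁ ^ 2 + c₂ ^ 2 := ⟨_, rfl⟩
  obtain ⟨x, hxd⟩ : ∃ x, x = c₁ * a₁ + c₂ * a₂ := ⟨_, rfl⟩
  obtain ⟨y, hyd⟩ : ∃ y, y = c₁ * a₂ - c₂ * a₁ := ⟨_, rfl⟩
  obtain ⟨u, hud⟩ : ∃ u, u = c₁ * b₁ + c₂ * b₂ := ⟨_, rfl⟩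
  obtain ⟨v, hvd⟩ : ∃ v, v = c₁ * b₂ - c₂ * b₁ := ⟨_, rfl⟩
  rw [← hLd] at hL
  rw [← hyd, ← hvd] at hx
  have e1 : x * u + y * v = L * (a₁ * b₁ + a₂ * b₂) := by rw [hxd, hud, hyd, hvd, hLd]; ring
  have k1 : 0 ≤ x * u + y * v := e1 ▸ mul_nonneg hL.le h1
  have k2 : x * (L - x) ≤ y ^ 2 := by
    have := mul_nonneg hL.le h2
    have e : L * (a₁ * (a₁ - c₁) + a₂ * (a₂ - c₂)) = x ^ 2 + y ^ 2 - L * x := by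
      rw [hxd, hyd, hLd]; ring
    nlinarith
  have k3 : 0 ≤ (L - x) * (L - u) + y * v := by
    have := mul_nonneg hL.le h3
    have e : L * ((c₁ - a₁) * (c₁ - b₁) + (c₂ - a₂) * (c₂ - b₂)) = (L - x) * (L - u) + y * v := by
      rw [hxd, hyd, hLd, hud, hvd]; ring
    rwa [← e]
  have k4 : u * (L - u) ≤ v ^ 2 := by
    have := mul_nonneg hL.le h4
    have e : L * (b₁ * (b₁ - c₁) + b₂ * (b₂ - c₂)) = u ^ 2 + v ^ 2 - L * u := by
      rw [hud, hvd, hLd]; ring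
    nlinarith
  have k5 : 0 ≤ x := by rw [hxd]; linarith
  have k6 : 0 ≤ L - u := by rw [hLd, hud]; linarith
  have xu : 0 < x * u := by linarith
  have lxu : 0 < (L - x) * (L - u) := by linarith
  have hx0 : 0 < x := lt_of_le_of_ne k5 (by rintro rfl; simp at xu)
  have hu0 : 0 < u := pos_of_mul_pos_right xu k5
  have hlu : 0 < L - u := lt_of_le_of_ne k6 (by intro h; rw [← h] at lxu; simp at lxu)
  have hlx : 0 < L - x := pos_of_mul_pos_left lxu k6
  -- Both `x * u` and `(L - x) * (L - u)` are at least `-(y * v) > 0`, so this bound on their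
  -- product forces equality in both.
  have k7 : (x * u) * ((L - x) * (L - u)) ≤ (y * v) ^ 2 := by
    have := mul_le_mul k2 k4 (by positivity) (by positivity)
    nlinarith
  have e2 : x * u = -(y * v) := by
    by_contra hne
    have : -(y * v) < x * u := lt_of_le_of_ne (by linarith) (Ne.symm hne)
    nlinarith
  have e3 : (L - x) * (L - u) = -(y * v) := by
    by_contra hne
    have : -(y * v) < (L - x) * (L - u) := lt_of_le_of_ne (by linarith) (Ne.symm hne)
    nlinarith
  have e4 : x + u = L := by
    have : L * (L - x - u) = 0 := by
      linarith [e2, e3, show (L - x) * (L - u) = L * (L - x - u) + x * u by ring]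
    rcases mul_eq_zero.1 this with h | h <;> linarith
  have e5 : y + v = 0 := by
    have p1 : -(y * v) ≤ y ^ 2 := by rw [← e2]; rw [show u = L - x by linarith]; exact k2
    have p2 : -(y * v) ≤ v ^ 2 := by
      rw [← e2]; rw [show x = L - u by linarith, mul_comm]; exact k4
    have q1 : 0 ≤ y * (y + v) := by linarith [show y * (y + v) = y ^ 2 + y * v by ring]
    have q2 : 0 ≤ v * (y + v) := by linarith [show v * (y + v) = v ^ 2 + y * v by ring]
    have q3 : 0 ≤ (y * v) * (y + v) ^ 2 := by
      have := mul_nonneg q1 q2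
      linarith [show y * (y + v) * (v * (y + v)) = (y * v) * (y + v) ^ 2 by ring]
    have q4 : (y + v) ^ 2 ≤ 0 := nonpos_of_mul_nonneg_right q3 hx
    exact pow_eq_zero_iff (two_ne_zero) |>.1 (le_antisymm q4 (sq_nonneg _))
  have e6 : L * (a₁ + b₁ - c₁) = 0 := by
    have : L * (a₁ + b₁ - c₁) = c₁ * (x + u - L) - c₂ * (y + v) := by
      rw [hxd, hyd, hLd, hud, hvd]; ring
    rw [this, e4, e5]; ring
  have e7 : L * (a₂ + b₂ - c₂) = 0 := by
    have : L * (a₂ + b₂ - c₂) = c₂ * (x + u - L) + c₁ * (y + v) := by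
      rw [hxd, hyd, hLd, hud, hvd]; ring
    rw [this, e4, e5]; ring
  have e8 : L * (a₁ * b₁ + a₂ * b₂) = 0 := by rw [← e1, e2]; ring
  have hne := hL.ne'
  refine ⟨?_, ?_, ?_⟩
  · linarith [(mul_eq_zero.1 e6).resolve_left hne]
  · linarith [(mul_eq_zero.1 e7).resolve_left hne]
  · exact (mul_eq_zero.1 e8).resolve_left hne

/-- `IsDoubleNormal V p q` says that `{p, q}` is a double-normal pair of `V`. -/
def IsDoubleNormal (V : Finset Plane) (p q : Plane) : Prop :=
  p ∈ V ∧ q ∈ V ∧ p ≠ q ∧ ∀ x ∈ V, x ∈ closedStrip p q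

namespace IsDoubleNormal

variable {V : Finset Plane} {p q a b : Plane}

lemma left_mem (h : IsDoubleNormal V p q) : p ∈ V := h.1
lemma right_mem (h : IsDoubleNormal V p q) : q ∈ V := h.2.1
lemma ne (h : IsDoubleNormal V p q) : p ≠ q := h.2.2.1

lemma symm (h : IsDoubleNormal V p q) : IsDoubleNormal V q p :=
  ⟨h.2.1, h.1, h.ne.symm, fun x hx => ⟨(h.2.2.2 x hx).2, (h.2.2.2 x hx).1⟩⟩

lemma dot_nonneg (h : IsDoubleNormal V p q) {x : Plane} (hx : x ∈ V) :
    0 ≤ (x 0 - p 0) * (q 0 - p 0) + (x 1 - p 1) * (q 1 - p 1) :=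
  (mem_closedStrip.1 (h.2.2.2 x hx)).1

/-- The strips bound the dot product of `a - p` and `b - p` by both squared lengths; for parallel
vectors this is possible only if they coincide. It upgrades weak left-right comparisons to strict
ones. -/
lemma eq_of_cross_eq_zero (ha : IsDoubleNormal V p a) (hb : IsDoubleNormal V p b)
    (h : cross (a - p) (b - p) = 0) : a = b := by
  rw [cross_sub] at h
  have h1 := ha.dot_nonneg hb.right_mem
  have h2 := ha.symm.dot_nonneg hb.right_mem
  have h3 := hb.symm.dot_nonneg ha.right_mem
  have h4 := ne_iff_sq_pos.1 ha.ne
  have h5 := ne_iff_sq_pos.1 hb.ne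
  by_contra hne
  have h6 := ne_iff_sq_pos.1 hne
  obtain ⟨A, hA⟩ : ∃ A, A = (p 0 - a 0) ^ 2 + (p 1 - a 1) ^ 2 := ⟨_, rfl⟩
  obtain ⟨B, hB⟩ : ∃ B, B = (p 0 - b 0) ^ 2 + (p 1 - b 1) ^ 2 := ⟨_, rfl⟩
  obtain ⟨C, hC⟩ : ∃ C, C = (b 0 - p 0) * (a 0 - p 0) + (b 1 - p 1) * (a 1 - p 1) := ⟨_, rfl⟩
  rw [← hA] at h4
  rw [← hB] at h5
  rw [← hC] at h1
  have k1 : C ≤ A := by rw [hA, hC]; linarith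
  have k2 : C ≤ B := by rw [hB, hC]; linarith
  have k3 : A * B = C ^ 2 := by
    have : A * B = C ^ 2 + ((a 0 - p 0) * (b 1 - p 1) - (a 1 - p 1) * (b 0 - p 0)) ^ 2 := by
      rw [hA, hB, hC]; ring
    rw [this, h]; ring
  have k4 : 0 < A + B - 2 * C := by
    have : A + B - 2 * C = (a 0 - b 0) ^ 2 + (a 1 - b 1) ^ 2 := by rw [hA, hB, hC]; ring
    rwa [this]
  have k5 : 0 < C := by
    rcases h1.eq_or_lt with h | h
    · rw [← h] at k3; nlinarith [mul_pos h4 h5]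
    · exact h
  have k6 : (A - C) * B + C * (B - C) = 0 := by
    linarith [show (A - C) * B + C * (B - C) = A * B - C ^ 2 by ring]
  have k7 := mul_nonneg (sub_nonneg.2 k1) h5.le
  have k8 := mul_nonneg k5.le (sub_nonneg.2 k2)
  have k9 : (A - C) * B = 0 := by linarith
  have k10 : C * (B - C) = 0 := by linarith
  have := (mul_eq_zero.1 k9).resolve_right h5.ne'
  have := (mul_eq_zero.1 k10).resolve_left k5.ne'
  linarith

/-- Double normals `pa` and `qb` on opposite sides of `pq` are opposite sides of a rectangle. -/
lemma rectangle (ha : IsDoubleNormal V p a) (hb : IsDoubleNormal V q b)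
    (h : cross (q - p) (a - p) * cross (q - p) (b - p) < 0) :
    a + b = p + q ∧ (a 0 - p 0) * (b 0 - p 0) + (a 1 - p 1) * (b 1 - p 1) = 0 := by
  have h1 := ha.dot_nonneg hb.right_mem
  have h2 := ha.symm.dot_nonneg hb.left_mem
  have h3 := hb.dot_nonneg ha.right_mem
  have h4 := hb.symm.dot_nonneg ha.left_mem
  have h5 := ha.dot_nonneg hb.left_mem
  have h6 := hb.dot_nonneg ha.left_mem
  rw [cross_sub, cross_sub] at h
  obtain ⟨e1, e2, e3⟩ := rectangle_of_angles (a₁ := a 0 - p 0) (a₂ := a 1 - p 1)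
    (b₁ := b 0 - p 0) (b₂ := b 1 - p 1) (c₁ := q 0 - p 0) (c₂ := q 1 - p 1)
    (by linarith) (by linarith) (by linarith) (by linarith) (by linarith) (by linarith) h
  refine ⟨ext_coord ?_ ?_, e3⟩ <;> simp <;> linarith

end IsDoubleNormal

/-! ### Leftmost neighbours and residual double normals. -/

/-- Pairwise non-obtuse nonzero vectors have a leftmost one. -/
lemma exists_leftmost {S : Finset Plane} (hS : S.Nonempty) (p : Plane)
    (h0 : ∀ a ∈ S, a ≠ p)
    (h : ∀ a ∈ S, ∀ b ∈ S, 0 ≤ (a 0 - p 0) * (b 0 - p 0) + (a 1 - p 1) * (b 1 - p 1)) :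
    ∃ m ∈ S, ∀ x ∈ S, cross (m - p) (x - p) ≤ 0 := by
  induction hS using Finset.Nonempty.cons_induction with
  | singleton a => exact ⟨a, by simp, by simp [cross, mul_comm]⟩
  | cons a s ha hs ih =>
    obtain ⟨m, hm, hmx⟩ := ih (fun b hb => h0 b (by simp [hb]))
      (fun b hb c hc => h b (by simp [hb]) c (by simp [hc]))
    by_cases hma : cross (m - p) (a - p) ≤ 0
    · refine ⟨m, by simp [hm], fun x hx => ?_⟩
      rcases Finset.mem_cons.1 hx with rfl | hx
      exacts [hma, hmx x hx]
    · refine ⟨a, by simp, fun x hx => ?_⟩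
      rcases Finset.mem_cons.1 hx with rfl | hx
      · simp [cross, mul_comm]
      by_contra hax
      push Not at hma hax
      have hmx := hmx x hx
      have h1 := h m (by simp [hm]) a (by simp)
      have h2 := h a (by simp) x (by simp [hx])
      have h3 := h m (by simp [hm]) x (by simp [hx])
      have h4 := ne_iff_sq_pos.1 (h0 a (by simp))
      rw [cross_sub] at *
      generalize m 0 - p 0 = m0 at *
      generalize m 1 - p 1 = m1 at *
      generalize x 0 - p 0 = x0 at *
      generalize x 1 - p 1 = x1 at *
      generalize a 0 - p 0 = a0 at *
      generalize a 1 - p 1 = a1 at *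
      -- The addition formulas for sine and cosine: two left turns adding up to no left turn would
      -- make the angle from `m` to `x` obtuse.
      have e1 : (a0 ^ 2 + a1 ^ 2) * (m0 * x1 - m1 * x0) =
        (m0 * a1 - m1 * a0) * (a0 * x0 + a1 * x1) + (m0 * a0 + m1 * a1) * (a0 * x1 - a1 * x0) := by
        ring
      have e2 : (a0 ^ 2 + a1 ^ 2) * (m0 * x0 + m1 * x1) =
        (m0 * a0 + m1 * a1) * (a0 * x0 + a1 * x1) - (m0 * a1 - m1 * a0) * (a0 * x1 - a1 * x0) := by
        ring
      have k1 := mul_nonneg hma.le h2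
      have k2 := mul_nonneg h1 hax.le
      have k3 := mul_nonpos_of_nonneg_of_nonpos h4.le hmx
      have k4 := mul_pos hma hax
      have k5 := mul_nonneg h4.le h3
      have k6 : (m0 * a1 - m1 * a0) * (a0 * x0 + a1 * x1) = 0 := by linarith
      have k7 := (mul_eq_zero.1 k6).resolve_left hma.ne'
      rw [k7] at e2
      linarith

/-- The leftmost neighbour of `p` in the double-normal graph of `V` (or `p` if there is none). -/
noncomputable def leftNbr (V : Finset Plane) (p : Plane) : Plane :=
  open Classical in
  if h : ∃ q, IsDoubleNormal V p q ∧ ∀ x, IsDoubleNormal V p x → cross (q - p) (x - p) ≤ 0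
  then h.choose else p

/-- The double normals that are leftmost at neither end. -/
def IsResidual (V : Finset Plane) (p q : Plane) : Prop :=
  IsDoubleNormal V p q ∧ leftNbr V p ≠ q ∧ leftNbr V q ≠ p

section

variable {V : Finset Plane} {p q r s : Plane}

namespace IsDoubleNormal

lemma leftNbr_spec (h : IsDoubleNormal V p q) : IsDoubleNormal V p (leftNbr V p) ∧
    ∀ x, IsDoubleNormal V p x → cross (leftNbr V p - p) (x - p) ≤ 0 := by
  classical
  have h1 : ∃ q, IsDoubleNormal V p q ∧
      ∀ x, IsDoubleNormal V p x → cross (q - p) (x - p) ≤ 0 := by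
    obtain ⟨m, hm, hx⟩ := exists_leftmost (S := V.filter (IsDoubleNormal V p))
      ⟨q, by simp [h, h.right_mem]⟩ p (fun a ha => (Finset.mem_filter.1 ha).2.ne.symm)
      (fun a ha b hb => (Finset.mem_filter.1 hb).2.dot_nonneg (Finset.mem_filter.1 ha).1)
    exact ⟨m, (Finset.mem_filter.1 hm).2,
      fun x h => hx x (Finset.mem_filter.2 ⟨h.right_mem, h⟩)⟩
  rw [leftNbr, dif_pos h1]
  exact h1.choose_spec

lemma leftNbr (h : IsDoubleNormal V p q) : IsDoubleNormal V p (leftNbr V p) := h.leftNbr_spec.1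

lemma cross_leftNbr_neg (h : IsDoubleNormal V p q) (hq : _root_.leftNbr V p ≠ q) :
    cross (_root_.leftNbr V p - p) (q - p) < 0 :=
  lt_of_le_of_ne (h.leftNbr_spec.2 q h) fun h0 => hq (h.leftNbr.eq_of_cross_eq_zero h h0)

end IsDoubleNormal

lemma Plane.cross_comm (x y : Plane) : cross x y = -cross y x := by simp [cross]; ring

namespace IsResidual

lemma symm (h : IsResidual V p q) : IsResidual V q p := ⟨h.1.symm, h.2.2, h.2.1⟩

lemma cross_pos (h : IsResidual V p q) : 0 < cross (q - p) (leftNbr V p - p) := by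
  rw [cross_comm]
  exact neg_pos.2 (h.1.cross_leftNbr_neg h.2.1)

lemma cross_neg (h : IsResidual V p q) : cross (q - p) (leftNbr V q - p) < 0 := by
  have := h.symm.cross_pos
  rw [cross_sub] at *
  linarith

lemma rectangle (h : IsResidual V p q) : leftNbr V p + leftNbr V q = p + q ∧
    (leftNbr V p 0 - p 0) * (leftNbr V q 0 - p 0) +
      (leftNbr V p 1 - p 1) * (leftNbr V q 1 - p 1) = 0 :=
  h.1.leftNbr.rectangle h.symm.1.leftNbr (mul_neg_of_pos_of_neg h.cross_pos h.cross_neg)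

/-- If `q` were left of `pr`, then `pq` and the leftmost double normal at `r` would span a rectangle
with diagonal `pr`. So would `leftNbr V p`, and the fourth vertex is unique. -/
lemma not_left (hq : IsResidual V p q) (hr : IsResidual V p r) :
    ¬ 0 < cross (r - p) (q - p) := fun h => by
  have h1 := hr.rectangle
  have h2 := hq.1.rectangle hr.symm.1.leftNbr (mul_neg_of_pos_of_neg h hr.cross_neg)
  exact hq.2.1 (add_right_cancel (h1.1.trans h2.1.symm))

lemma unique (hq : IsResidual V p q) (hr : IsResidual V p r) : q = r := by
  refine hq.1.eq_of_cross_eq_zero hr.1 (le_antisymm (not_lt.1 (hr.not_left hq)) ?_)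
  have := hq.not_left hr
  rw [cross_comm]
  linarith

/-- The rectangle on `pr` has a right angle at the common leftmost neighbour `f`, between `p` and
`r`. Turning from `p` to `q`, away from `r`, would make the angle at `f` between `r` and `q` obtuse.
-/
lemma not_obtuse (hp : IsResidual V p r) (hq : IsDoubleNormal V q s)
    (h : leftNbr V p = leftNbr V q) : ¬ 0 < cross (q - leftNbr V p) (p - leftNbr V p) := by
  intro hc
  have h1 := hp.rectangle
  have h2 := hp.cross_pos
  have h3 := (h ▸ hq.leftNbr.symm).dot_nonneg hp.1.right_mem
  have h4 := (h ▸ hq.leftNbr.symm).dot_nonneg hp.1.left_mem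
  have h5 := hp.1.leftNbr.symm.dot_nonneg hp.1.right_mem
  have e0 := congrArg (· 0) h1.1
  have e1 := congrArg (· 1) h1.1
  have h6 := h1.2
  have h7 := ne_iff_sq_pos.1 hp.1.leftNbr.ne
  simp only [PiLp.add_apply] at e0 e1
  rw [cross_sub] at *
  rw [eq_sub_of_add_eq' e0, eq_sub_of_add_eq' e1] at h6
  generalize leftNbr V p = f at *
  have e : ((p 0 - f 0) ^ 2 + (p 1 - f 1) ^ 2) *
      ((r 0 - f 0) * (q 0 - f 0) + (r 1 - f 1) * (q 1 - f 1)) =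
      ((p 0 - f 0) * (q 0 - f 0) + (p 1 - f 1) * (q 1 - f 1)) *
        ((r 0 - f 0) * (p 0 - f 0) + (r 1 - f 1) * (p 1 - f 1)) -
      ((q 0 - f 0) * (p 1 - f 1) - (q 1 - f 1) * (p 0 - f 0)) *
      ((r 0 - p 0) * (f 1 - p 1) - (r 1 - p 1) * (f 0 - p 0)) := by ring
  have e' : (r 0 - f 0) * (p 0 - f 0) + (r 1 - f 1) * (p 1 - f 1) = 0 := by linarith
  rw [e'] at e
  have k1 := mul_nonneg h7.le h3
  have k2 := mul_pos hc h2
  linarith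

lemma eq_of_leftNbr_eq (hp : IsResidual V p r) (hq : IsResidual V q s)
    (h : leftNbr V p = leftNbr V q) : p = q := by
  refine hp.1.leftNbr.symm.eq_of_cross_eq_zero (b := q) (h ▸ hq.1.leftNbr.symm) (le_antisymm ?_ ?_)
  · have := hq.not_obtuse hp.1 h.symm
    rw [← h] at this
    exact not_lt.1 this
  · have := hp.not_obtuse hq.1 h
    rw [cross_comm]
    linarith

end IsResidual

end

/-! ### Counting ordered double-normal pairs. -/

section Counting

open Classical in
/-- The ordered double-normal pairs of `V`. -/
noncomputable def doubleNormalPairs (V : Finset Plane) : Finset (Plane × Plane) :=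
  (V ×ˢ V).filter fun x => IsDoubleNormal V x.1 x.2

open Classical in
/-- The points of `V` that lie on a double normal. -/
noncomputable def nonisolated (V : Finset Plane) : Finset Plane :=
  V.filter fun p => ∃ q, IsDoubleNormal V p q

open Classical in
/-- The points of `V` that lie on a residual double normal. -/
noncomputable def matched (V : Finset Plane) : Finset Plane :=
  V.filter fun p => ∃ q, IsResidual V p q

variable {V : Finset Plane} {p q : Plane}

lemma mem_doubleNormalPairs {x : Plane × Plane} :
    x ∈ doubleNormalPairs V ↔ IsDoubleNormal V x.1 x.2 := by
  simp only [doubleNormalPairs, Finset.mem_filter, Finset.mem_product, and_iff_right_iff_imp]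
  exact fun h => ⟨h.left_mem, h.right_mem⟩

lemma mem_nonisolated : p ∈ nonisolated V ↔ ∃ q, IsDoubleNormal V p q := by
  simp only [nonisolated, Finset.mem_filter, and_iff_right_iff_imp]
  exact fun ⟨_, h⟩ => h.left_mem

lemma mem_matched : p ∈ matched V ↔ ∃ q, IsResidual V p q := by
  simp only [matched, Finset.mem_filter, and_iff_right_iff_imp]
  exact fun ⟨_, h⟩ => h.1.left_mem

lemma matched_subset : matched V ⊆ V := by
  exact fun _ h => (mem_matched.1 h).choose_spec.1.left_mem
lemma nonisolated_subset : nonisolated V ⊆ V := by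
  exact fun _ h => (mem_nonisolated.1 h).choose_spec.left_mem

lemma adj_iff {p q : V} : (doubleNormalGraph V).Adj p q ↔ IsDoubleNormal V p q := by
  simp only [doubleNormalGraph, IsDoubleNormal, SetLike.coe_mem, true_and, ne_eq, Subtype.ext_iff]
  rfl

lemma card_doubleNormalPairs : (doubleNormalPairs V).card = 2 * numDoubleNormals V := by
  classical
  rw [numDoubleNormals, ← SimpleGraph.coe_edgeFinset, Set.ncard_coe_finset,
    ← SimpleGraph.dart_card_eq_twice_card_edges, ← Finset.card_univ]
  symm
  refine Finset.card_bij (fun d _ => ((d.fst : Plane), (d.snd : Plane))) ?_ ?_ ?_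
  · intro d _
    exact mem_doubleNormalPairs.2 (adj_iff.1 d.adj)
  · intro d _ e _ h
    rw [Prod.mk.injEq] at h
    exact SimpleGraph.Dart.ext _ _ (Prod.ext (Subtype.ext h.1) (Subtype.ext h.2))
  · rintro ⟨a, b⟩ h
    have h := mem_doubleNormalPairs.1 h
    exact ⟨⟨(⟨a, h.left_mem⟩, ⟨b, h.right_mem⟩), adj_iff.2 h⟩, Finset.mem_univ _, rfl⟩

/-- The other end of the residual double normal at `p` (or `p` if there is none). -/
noncomputable def partner (V : Finset Plane) (p : Plane) : Plane :=
  open Classical in if h : ∃ q, IsResidual V p q then h.choose else p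

lemma isResidual_partner (h : p ∈ matched V) : IsResidual V p (partner V p) := by
  rw [partner, dif_pos (mem_matched.1 h)]
  exact (mem_matched.1 h).choose_spec

lemma IsResidual.partner_eq (h : IsResidual V p q) : partner V p = q :=
  (isResidual_partner (mem_matched.2 ⟨q, h⟩)).unique h

lemma partner_mem (h : p ∈ matched V) : partner V p ∈ matched V :=
  mem_matched.2 ⟨p, (isResidual_partner h).symm⟩

lemma partner_partner (h : p ∈ matched V) : partner V (partner V p) = p :=
  (isResidual_partner h).symm.partner_eq

lemma even_card_matched : Even (matched V).card := by
  classical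
  rw [← ZMod.natCast_eq_zero_iff_even, Finset.card_eq_sum_ones, Nat.cast_sum]
  refine Finset.sum_involution (fun p _ => partner V p) (fun _ _ => by decide) ?_
    (fun p h => partner_mem h) (fun p h => partner_partner h)
  exact fun p h _ => (isResidual_partner h).1.ne.symm

-- Each ordered pair is leftmost from its first end (`A`), leftmost from its second (`B`), or
-- residual (`R`). Mutually leftmost pairs lie in `A ∩ B`, which gives the correction term on the
-- left.
open Classical in
lemma card_pairs_add_le : 2 * numDoubleNormals V +
    ((nonisolated V).filter fun p => leftNbr V (leftNbr V p) = p).card ≤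
      2 * (nonisolated V).card + (matched V).card := by
  set A := (nonisolated V).image fun p => (p, leftNbr V p) with hA
  set B := (nonisolated V).image fun p => (leftNbr V p, p) with hB
  set R := (matched V).image fun p => (p, partner V p) with hR
  have h1 : doubleNormalPairs V ⊆ (A ∪ B) ∪ R := by
    rintro ⟨p, q⟩ h
    have h := mem_doubleNormalPairs.1 h
    simp only [Finset.mem_union]
    by_cases h1 : leftNbr V p = q
    · exact Or.inl (Or.inl (Finset.mem_image.2 ⟨p, mem_nonisolated.2 ⟨q, h⟩, by rw [h1]⟩))
    by_cases h2 : leftNbr V q = p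
    · exact Or.inl (Or.inr (Finset.mem_image.2 ⟨q, mem_nonisolated.2 ⟨p, h.symm⟩, by rw [h2]⟩))
    have h3 : IsResidual V p q := ⟨h, h1, h2⟩
    exact Or.inr (Finset.mem_image.2 ⟨p, mem_matched.2 ⟨q, h3⟩, by rw [h3.partner_eq]⟩)
  have h2 : ((nonisolated V).filter fun p => leftNbr V (leftNbr V p) = p).card ≤ (A ∩ B).card := by
    refine Finset.card_le_card_of_injOn (fun p => (p, leftNbr V p)) ?_ ?_
    · intro p hp
      simp only [Finset.coe_filter, Set.mem_ofPred_eq] at hp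
      obtain ⟨hp, hpp⟩ := hp
      obtain ⟨q, hq⟩ := mem_nonisolated.1 hp
      simp only [Finset.coe_inter, Set.mem_inter_iff, Finset.mem_coe]
      refine ⟨Finset.mem_image_of_mem _ hp, Finset.mem_image.2 ⟨leftNbr V p,
        mem_nonisolated.2 ⟨p, hq.leftNbr.symm⟩, by rw [hpp]⟩⟩
    · intro p _ q _ h
      exact (Prod.mk.inj h).1
  have h3 := Finset.card_union_add_card_inter A B
  have h4 := Finset.card_union_le (A ∪ B) R
  have h5 := Finset.card_le_card h1
  have h6 : A.card ≤ _ := Finset.card_image_le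
  have h7 : B.card ≤ _ := Finset.card_image_le
  have h8 : R.card ≤ _ := Finset.card_image_le
  rw [card_doubleNormalPairs] at h5
  omega

end Counting

/-! ### Inequalities for the equality case. -/

/-- If `A`, `T`, `W` are such that `T` and `W` are perpendicular to `A`, as is `B`, and the
indicated angles are not obtuse, then `W = -B`. -/
lemma eq_neg_of_angles {A₀ A₁ B₀ B₁ T₀ T₁ W₀ W₁ : ℝ}
    (hB : A₀ * B₀ + A₁ * B₁ = 0) (hT : A₀ * T₀ + A₁ * T₁ = 0) (hW : A₀ * W₀ + A₁ * W₁ = 0)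
    (hA : 0 < A₀ ^ 2 + A₁ ^ 2)
    (hτ : A₀ * T₁ - A₁ * T₀ < 0) (hω : 0 < A₀ * W₁ - A₁ * W₀)
    (h1 : 0 ≤ (B₀ - T₀) * (A₀ - T₀) + (B₁ - T₁) * (A₁ - T₁))
    (h2 : 0 ≤ (-B₀ - W₀) * (-A₀ - W₀) + (-B₁ - W₁) * (-A₁ - W₁))
    (h3 : 0 ≤ (B₀ + W₀) * (T₀ - A₀) + (B₁ + W₁) * (T₁ - A₁)) :
    B₀ + W₀ = 0 ∧ B₁ + W₁ = 0 := by
  obtain ⟨L, hL⟩ : ∃ L, L = A₀ ^ 2 + A₁ ^ 2 := ⟨_, rfl⟩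
  obtain ⟨β, hβ⟩ : ∃ β, β = A₀ * B₁ - A₁ * B₀ := ⟨_, rfl⟩
  obtain ⟨τ, hτd⟩ : ∃ τ, τ = A₀ * T₁ - A₁ * T₀ := ⟨_, rfl⟩
  obtain ⟨ω, hωd⟩ : ∃ ω, ω = A₀ * W₁ - A₁ * W₀ := ⟨_, rfl⟩
  rw [← hL] at hA
  rw [← hτd] at hτ
  rw [← hωd] at hω
  have dot : ∀ x₀ x₁ y₀ y₁ : ℝ, L * (x₀ * y₀ + x₁ * y₁) =
      (A₀ * x₀ + A₁ * x₁) * (A₀ * y₀ + A₁ * y₁) +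
        (A₀ * x₁ - A₁ * x₀) * (A₀ * y₁ - A₁ * y₀) := by
    intros; rw [hL]; ring
  have k1 : 0 ≤ τ * (τ - β) := by
    have h := mul_nonneg hA.le h1
    rw [dot] at h
    have e : A₀ * (B₀ - T₀) + A₁ * (B₁ - T₁) = 0 := by linarith
    rw [e] at h
    rw [hτd, hβ]
    linarith
  have k2 : 0 ≤ ω * (ω + β) := by
    have h := mul_nonneg hA.le h2
    rw [dot] at h
    have e : A₀ * (-B₀ - W₀) + A₁ * (-B₁ - W₁) = 0 := by linarith
    rw [e] at h
    rw [hωd, hβ]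
    linarith
  have k3 : 0 ≤ τ * (β + ω) := by
    have h := mul_nonneg hA.le h3
    rw [dot] at h
    have e : A₀ * (B₀ + W₀) + A₁ * (B₁ + W₁) = 0 := by linarith
    rw [e] at h
    rw [hωd, hβ, hτd]
    linarith
  -- All the vectors are multiples of the normal to `A`, so only the signs of `ω` and `τ` matter:
  -- they give opposite inequalities for `β + ω`.
  have k4 : 0 ≤ ω + β := nonneg_of_mul_nonneg_right k2 hω
  have k5 : β + ω ≤ 0 := by
    by_contra! h
    linarith [mul_neg_of_neg_of_pos hτ h]
  have k6 : A₀ * (B₁ + W₁) - A₁ * (B₀ + W₀) = 0 := by linarith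
  have k7 : A₀ * (B₀ + W₀) + A₁ * (B₁ + W₁) = 0 := by linarith
  have e1 : L * (B₀ + W₀) = A₀ * (A₀ * (B₀ + W₀) + A₁ * (B₁ + W₁)) -
    A₁ * (A₀ * (B₁ + W₁) - A₁ * (B₀ + W₀)) := by rw [hL]; ring
  have e2 : L * (B₁ + W₁) = A₁ * (A₀ * (B₀ + W₀) + A₁ * (B₁ + W₁)) +
    A₀ * (A₀ * (B₁ + W₁) - A₁ * (B₀ + W₀)) := by rw [hL]; ring
  rw [k6, k7] at e1 e2
  simp only [mul_zero, sub_zero, add_zero, mul_eq_zero, hA.ne', false_or] at e1 e2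
  exact ⟨e1, e2⟩

/-- A point of the triangle spanned by the origin and two points `w`, `k` of a circle around it
lies in the disc; if it lies on the circle and is not further from `w` than from `k`,
it is `w`. -/
lemma sq_le_of_left_of_chord {w₀ w₁ k₀ k₁ v₀ v₁ R : ℝ}
    (hw : w₀ ^ 2 + w₁ ^ 2 = R) (hk : k₀ ^ 2 + k₁ ^ 2 = R) (hwk : 0 < w₀ * k₁ - w₁ * k₀)
    (hv : 0 ≤ (k₀ - w₀) * (v₁ - w₁) - (k₁ - w₁) * (v₀ - w₀))
    (hle : k₀ * v₀ + k₁ * v₁ ≤ w₀ * v₀ + w₁ * v₁) (hc : 0 ≤ w₀ * v₁ - w₁ * v₀) :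
    v₀ ^ 2 + v₁ ^ 2 ≤ R ∧ (v₀ ^ 2 + v₁ ^ 2 = R → v₀ = w₀ ∧ v₁ = w₁) := by
  obtain ⟨D, hD⟩ : ∃ D, D = w₀ * k₁ - w₁ * k₀ := ⟨_, rfl⟩
  obtain ⟨x, hx⟩ : ∃ x, x = v₀ * k₁ - v₁ * k₀ := ⟨_, rfl⟩
  obtain ⟨y, hy⟩ : ∃ y, y = w₀ * v₁ - w₁ * v₀ := ⟨_, rfl⟩
  obtain ⟨S, hS⟩ : ∃ S, S = R - (w₀ * k₀ + w₁ * k₁) := ⟨_, rfl⟩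
  rw [← hD] at hwk
  rw [← hy] at hc
  have hR : 0 < R := by
    rw [← hw]
    rcases eq_or_ne w₀ 0 with h | h
    · rcases eq_or_ne w₁ 0 with h' | h'
      · rw [hD, h, h'] at hwk; simp at hwk
      · positivity
    · positivity
  have hS0 : 0 < S := by
    have h0 : 0 ≤ S := by
      rw [hS]; nlinarith [sq_nonneg (w₀ - k₀), sq_nonneg (w₁ - k₁)]
    refine lt_of_le_of_ne h0 fun h => ?_
    have : D ^ 2 + (R - S) ^ 2 = R * R := by
      rw [hD, hS]; linear_combination (k₀ ^ 2 + k₁ ^ 2) * hw + R * hk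
    rw [← h] at this
    nlinarith
  -- Cramer's rule: `x / D` and `y / D` are the coordinates of `v` in the basis `w`, `k`.
  have e0 : D * v₀ = x * w₀ + y * k₀ := by rw [hD, hx, hy]; ring
  have e1 : D * v₁ = x * w₁ + y * k₁ := by rw [hD, hx, hy]; ring
  have h1 : x + y ≤ D := by rw [hx, hy, hD]; linarith
  have h2 : y ≤ x := by
    have e : D * (w₀ * v₀ + w₁ * v₁ - (k₀ * v₀ + k₁ * v₁)) = (x - y) * S := by
      have : D * (w₀ * v₀ + w₁ * v₁ - (k₀ * v₀ + k₁ * v₁)) =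
        (w₀ - k₀) * (D * v₀) + (w₁ - k₁) * (D * v₁) := by ring
      rw [this, e0, e1, hS]
      linear_combination x * hw - y * hk
    have := mul_nonneg hwk.le (sub_nonneg.2 hle)
    rw [e] at this
    linarith [nonneg_of_mul_nonneg_left this hS0]
  have e2 : D ^ 2 * (v₀ ^ 2 + v₁ ^ 2) = (x + y) ^ 2 * R - 2 * (x * y) * S := by
    have : D ^ 2 * (v₀ ^ 2 + v₁ ^ 2) = (D * v₀) ^ 2 + (D * v₁) ^ 2 := by ring
    rw [this, e0, e1, hS]
    linear_combination x ^ 2 * hw + y ^ 2 * hk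
  have hx0 := hc.trans h2
  have h3 : (x + y) ^ 2 ≤ D ^ 2 := by gcongr
  have h4 : (x + y) ^ 2 * R ≤ D ^ 2 * R := by gcongr
  have h5 : 0 ≤ 2 * (x * y) * S := by positivity
  refine ⟨le_of_mul_le_mul_left (by linarith) (pow_pos hwk 2), fun h => ?_⟩
  rw [h] at e2
  have h6 : 2 * (x * y) * S = 0 := by linarith
  have h7 : ((x + y) ^ 2 - D ^ 2) * R = 0 := by linarith
  have h8 : x * y = 0 := by simpa [hS0.ne'] using h6
  have h9 : x + y = D := by
    have := (mul_eq_zero.1 h7).resolve_right hR.ne'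
    exact (pow_left_inj₀ (by positivity) hwk.le two_ne_zero).1 (by linarith)
  have hy0 : y = 0 := by
    rcases mul_eq_zero.1 h8 with h | h
    · linarith
    · exact h
  have hxD : x = D := by linarith
  rw [hy0, hxD] at e0 e1
  exact ⟨mul_left_cancel₀ hwk.ne' (by linarith), mul_left_cancel₀ hwk.ne' (by linarith)⟩

/-- A point to the left of all sides of a polygon inscribed in a circle lies in the disc, and in
the interior of the disc unless it is a vertex. -/
lemma sq_le_of_left_of_sides {O : Finset Plane} (hO : O.Nonempty) {h : Plane → Plane}
    (hh : Set.SurjOn h O O) (hmap : Set.MapsTo h O O) {c : Plane} {R : ℝ}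
    (hR : ∀ p ∈ O, (p 0 - c 0) ^ 2 + (p 1 - c 1) ^ 2 = R)
    (hpos : ∀ p ∈ O, 0 < cross (p - c) (h p - c)) {v : Plane}
    (hv : ∀ p ∈ O, 0 ≤ cross (h p - p) (v - p)) :
    (v 0 - c 0) ^ 2 + (v 1 - c 1) ^ 2 ≤ R ∧
      ((v 0 - c 0) ^ 2 + (v 1 - c 1) ^ 2 = R → v ∈ O) := by
  -- Maximal inner product picks a vertex nearest to `v`; the side leaving or entering it is used,
  -- according to the side of the ray `cw` on which `v` lies.
  obtain ⟨w, hw, hmax⟩ := O.exists_max_image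
    (fun w => (w 0 - c 0) * (v 0 - c 0) + (w 1 - c 1) * (v 1 - c 1)) hO
  rcases le_total 0 (cross (w - c) (v - c)) with hc | hc
  · have h1 := hpos w hw
    have h2 := hv w hw
    rw [cross_sub] at h1 h2 hc
    have := sq_le_of_left_of_chord (hR w hw) (hR _ (hmap hw)) h1 (by linarith)
      (hmax _ (hmap hw)) hc
    refine ⟨this.1, fun hvR => ?_⟩
    have := this.2 hvR
    rwa [show v = w from ext_coord (by linarith) (by linarith)]
  · obtain ⟨j, hj, rfl⟩ := hh hw
    have h1 := hpos j hj
    have h2 := hv j hj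
    rw [cross_sub] at h1 h2 hc
    -- Swapping the coordinates reflects the plane, which reverses the orientation of the entering
    -- side.
    have := sq_le_of_left_of_chord (w₀ := h j 1 - c 1) (w₁ := h j 0 - c 0) (k₀ := j 1 - c 1)
      (k₁ := j 0 - c 0) (v₀ := v 1 - c 1) (v₁ := v 0 - c 0) (R := R)
      (by rw [add_comm]; exact hR _ hw) (by rw [add_comm]; exact hR _ hj) (by linarith)
      (by linarith) (by have := hmax _ hj; linarith) (by linarith)
    rw [add_comm] at this
    refine ⟨this.1, fun hvR => ?_⟩
    have := this.2 hvR
    rwa [show v = h j from ext_coord (by linarith) (by linarith)]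

section

variable {V : Finset Plane} {p q s : Plane}

/-- A double normal at `q` other than the leftmost and the residual one is to the right of the
residual one. -/
lemma IsResidual.cross_pos_of_ne (hq : IsResidual V q s) (hp : IsDoubleNormal V q p)
    (hl : leftNbr V q ≠ p) (hs : s ≠ p) : 0 < cross (p - q) (s - q) := by
  by_contra! hcon
  have h1 : 0 < cross (s - q) (p - q) := by
    rw [cross_comm]
    refine lt_of_le_of_ne (by linarith) fun h => hs (hq.1.eq_of_cross_eq_zero hp ?_)
    rw [cross_comm]; linarith
  have h2 := hp.cross_leftNbr_neg hl
  have h3 := hq.cross_pos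
  have h4 := hq.rectangle
  have e0 := congrArg (· 0) h4.1
  have e1 := congrArg (· 1) h4.1
  have h6 := h4.2
  have h7 := ne_iff_sq_pos.1 hq.1.leftNbr.ne
  have h8 := hq.1.leftNbr.dot_nonneg hp.right_mem
  have h9 := hq.1.leftNbr.symm.dot_nonneg hp.right_mem
  have h10 := hp.symm.dot_nonneg hq.1.right_mem
  simp only [PiLp.add_apply] at e0 e1
  rw [cross_sub] at *
  rw [eq_sub_of_add_eq' e0, eq_sub_of_add_eq' e1] at h6
  generalize leftNbr V q = l at *
  -- Otherwise `p` lies in the right triangle `q`, `l`, `s`, off the side `ql` and the hypotenuse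
  -- `qs`. It is then strictly inside the circle with diameter `qs`, so its angle over `qs` is
  -- obtuse.
  obtain ⟨L, hL⟩ : ∃ L, L = (q 0 - l 0) ^ 2 + (q 1 - l 1) ^ 2 := ⟨_, rfl⟩
  obtain ⟨x, hx⟩ : ∃ x, x = (p 0 - q 0) * (l 0 - q 0) + (p 1 - q 1) * (l 1 - q 1) := ⟨_, rfl⟩
  obtain ⟨Y, hY⟩ : ∃ Y, Y = -((l 0 - q 0) * (p 1 - q 1) - (l 1 - q 1) * (p 0 - q 0)) := ⟨_, rfl⟩
  obtain ⟨B, hB⟩ : ∃ B, B = (s 0 - q 0) * (l 1 - q 1) - (s 1 - q 1) * (l 0 - q 0) := ⟨_, rfl⟩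
  have hsl : (s 0 - q 0) * (l 0 - q 0) + (s 1 - q 1) * (l 1 - q 1) = L := by rw [hL]; linarith
  rw [← hL] at h7
  rw [← hx] at h8
  have hY0 : 0 < Y := by rw [hY]; linarith
  rw [← hB] at h3
  have hxL : x ≤ L := by rw [hx, hL]; linarith
  have k1 : L * Y < B * x := by
    have e : L * ((s 0 - q 0) * (p 1 - q 1) - (s 1 - q 1) * (p 0 - q 0)) =
      ((s 0 - q 0) * (l 0 - q 0) + (s 1 - q 1) * (l 1 - q 1)) * (-Y) + B * x := by
      rw [hL, hY, hB, hx]; ring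
    rw [hsl] at e
    linarith [mul_pos h7 h1]
  have k2 : x * L + Y * B ≤ x ^ 2 + Y ^ 2 := by
    have e : L * ((s 0 - p 0) * (q 0 - p 0) + (s 1 - p 1) * (q 1 - p 1)) =
      x ^ 2 + Y ^ 2 - (x * ((s 0 - q 0) * (l 0 - q 0) + (s 1 - q 1) * (l 1 - q 1)) + Y * B) := by
      rw [hL, hY, hB, hx]; ring
    rw [hsl] at e
    linarith [mul_nonneg h7.le h10]
  have k3 : B * x ≤ B * L := by gcongr
  have k4 : Y < B := by
    by_contra! h
    linarith [mul_le_mul_of_nonneg_left h h7.le]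
  nlinarith [mul_pos hY0 (sub_pos.2 k4), mul_nonneg h8 (sub_nonneg.2 hxL)]

/-! ### Extremal sets lie on a circle. -/

/-- The sets for which the count of double normals is as large as possible. -/
structure IsExtremal (V : Finset Plane) : Prop where
  mem_matched : ∀ p ∈ V, p ∈ matched V
  leftNbr_leftNbr : ∀ p ∈ V, leftNbr V (leftNbr V p) ≠ p

namespace IsExtremal

variable (hV : IsExtremal V)
include hV

lemma isResidual (hp : p ∈ V) : IsResidual V p (partner V p) :=
  isResidual_partner (hV.mem_matched p hp)

lemma partner_mem (hp : p ∈ V) : partner V p ∈ V := (hV.isResidual hp).1.right_mem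

lemma partner_partner (hp : p ∈ V) : partner V (partner V p) = p :=
  _root_.partner_partner (hV.mem_matched p hp)

lemma isDoubleNormal_leftNbr (hp : p ∈ V) : IsDoubleNormal V p (leftNbr V p) :=
  (hV.isResidual hp).1.leftNbr

lemma leftNbr_mem (hp : p ∈ V) : leftNbr V p ∈ V := (hV.isDoubleNormal_leftNbr hp).right_mem

lemma injOn_leftNbr : Set.InjOn (leftNbr V) V :=
  fun _ hp _ hq h => (hV.isResidual hp).eq_of_leftNbr_eq (hV.isResidual hq) h

lemma surjOn_leftNbr : Set.SurjOn (leftNbr V) V V :=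
  Finset.surjOn_of_injOn_of_card_le _ (fun _ hp => hV.leftNbr_mem hp) hV.injOn_leftNbr le_rfl

/-- At `leftNbr V p` the double normal to `p` is neither leftmost nor residual, so it is right of
the residual one. -/
lemma cross_pos (hp : p ∈ V) :
    0 < cross (p - leftNbr V p) (partner V (leftNbr V p) - leftNbr V p) := by
  have hq := hV.isResidual (hV.leftNbr_mem hp)
  refine hq.cross_pos_of_ne (hV.isDoubleNormal_leftNbr hp).symm (hV.leftNbr_leftNbr p hp) ?_
  intro h
  rw [h] at hq
  exact hq.2.2 rfl

/-- The mirror image of `IsResidual.rectangle`. -/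
lemma dot_partner_leftNbr (hp : p ∈ V) :
    (leftNbr V p 0 - p 0) * (partner V (leftNbr V p) 0 - p 0) +
      (leftNbr V p 1 - p 1) * (partner V (leftNbr V p) 1 - p 1) = 0 := by
  have h1 := hV.cross_pos hp
  have hq := hV.leftNbr_mem hp
  -- Surjectivity supplies at the partner of `leftNbr V p` a double normal right of the residual
  -- one, the counterpart of the one from `leftNbr V p` to `p`.
  obtain ⟨p', hp', h⟩ := hV.surjOn_leftNbr (hV.partner_mem hq)
  have h2 := hV.cross_pos hp'
  have h3 := (hV.isDoubleNormal_leftNbr hp).symm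
  have h4 := (hV.isDoubleNormal_leftNbr hp').symm
  rw [h] at h2 h4
  rw [hV.partner_partner hq] at h2
  obtain ⟨e, h5⟩ := h3.rectangle h4 (by
    rw [cross_comm _ (p - _)]
    have : cross (partner V (leftNbr V p) - leftNbr V p) (p' - leftNbr V p) =
      cross (p' - partner V (leftNbr V p)) (leftNbr V p - partner V (leftNbr V p)) := by
      rw [cross_sub, cross_sub]; ring
    rw [this]
    exact mul_neg_of_neg_of_pos (neg_neg_of_pos h1) h2)
  have e0 := congrArg (· 0) e
  have e1 := congrArg (· 1) e
  simp only [PiLp.add_apply] at e0 e1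
  rw [show p' 0 - leftNbr V p 0 = partner V (leftNbr V p) 0 - p 0 by linarith,
    show p' 1 - leftNbr V p 1 = partner V (leftNbr V p) 1 - p 1 by linarith] at h5
  linarith

/-- Says that the other diagonal of the rectangle on a residual double normal is residual too. With
`q`, `r` its ends, the partners of `q` and `r` lie on lines through sides of the rectangle, and
`eq_neg_of_angles` makes `q` the partner of `r`. -/
lemma partner_leftNbr (hp : p ∈ V) : partner V (leftNbr V p) = leftNbr V (partner V p) := by
  have hu := hV.partner_mem hp
  have hq := hV.leftNbr_mem hp
  have hr := hV.leftNbr_mem hu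
  have ht := hV.partner_mem hq
  have hw := hV.partner_mem hr
  suffices h : partner V (leftNbr V (partner V p)) = leftNbr V p by
    rw [← h, hV.partner_partner hr]
  have h1 := (hV.isResidual hp).rectangle
  have h2 := hV.dot_partner_leftNbr hp
  have h3 := hV.dot_partner_leftNbr hu
  have h4 := hV.cross_pos hp
  have h5 := hV.cross_pos hu
  have h6 := (hV.isResidual hq).1.symm.dot_nonneg hr
  have h7 := (hV.isResidual hr).1.symm.dot_nonneg hq
  have h8 := (hV.isResidual hq).1.dot_nonneg hw
  have h9 := ne_iff_sq_pos.1 (hV.isDoubleNormal_leftNbr hp).ne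
  generalize leftNbr V (partner V p) = r at *
  generalize partner V (leftNbr V p) = t at *
  generalize leftNbr V p = q at *
  generalize partner V r = w at *
  generalize partner V p = u at *
  obtain ⟨e, h10⟩ := h1
  have e0 := congrArg (· 0) e
  have e1 := congrArg (· 1) e
  simp only [PiLp.add_apply] at e0 e1
  have e0 : u 0 = q 0 + r 0 - p 0 := by linarith
  have e1 : u 1 = q 1 + r 1 - p 1 := by linarith
  rw [cross_sub] at h4 h5
  rw [e0, e1] at h3 h5
  have := eq_neg_of_angles (A₀ := q 0 - p 0) (A₁ := q 1 - p 1) (B₀ := r 0 - p 0) (B₁ := r 1 - p 1)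
    (T₀ := t 0 - p 0) (T₁ := t 1 - p 1) (W₀ := w 0 - (q 0 + r 0 - p 0))
    (W₁ := w 1 - (q 1 + r 1 - p 1)) h10 h2 (by linarith) (by linarith) (by linarith)
    (by linarith) (by linarith) (by linarith) (by linarith)
  exact ext_coord (by linarith [this.1]) (by linarith [this.2])

/-- The last clause serves the odd case, where `z` is the deleted point. -/
theorem exists_circle (hne : V.Nonempty) : ∃ (c : Plane) (R : ℝ), 0 < R ∧
    (∀ v ∈ V, (v 0 - c 0) ^ 2 + (v 1 - c 1) ^ 2 = R) ∧ (∀ v ∈ V, c + c - v ∈ V) ∧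
    ∀ z, (∀ p q, IsDoubleNormal V p q → z ∈ closedStrip p q) →
      z ∉ V → (z 0 - c 0) ^ 2 + (z 1 - c 1) ^ 2 < R := by
  classical
  obtain ⟨p₀, hp₀, hmin⟩ := V.exists_min_image
    (fun p => (p 0 - partner V p 0) ^ 2 + (p 1 - partner V p 1) ^ 2) hne
  obtain ⟨c, hc⟩ : ∃ c : Plane, p₀ + partner V p₀ = c + c :=
    ⟨(1 / 2 : ℝ) • (p₀ + partner V p₀), by rw [← add_smul]; norm_num⟩
  obtain ⟨R, hRd⟩ : ∃ R, R = (p₀ 0 - c 0) ^ 2 + (p₀ 1 - c 1) ^ 2 := ⟨_, rfl⟩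
  have hc0 := congrArg (· 0) hc
  have hc1 := congrArg (· 1) hc
  simp only [PiLp.add_apply] at hc0 hc1
  have hdiam : (p₀ 0 - partner V p₀ 0) ^ 2 + (p₀ 1 - partner V p₀ 1) ^ 2 = 4 * R := by
    rw [hRd, show partner V p₀ 0 = c 0 + c 0 - p₀ 0 by linarith,
      show partner V p₀ 1 = c 1 + c 1 - p₀ 1 by linarith]
    ring
  have hRpos : 0 < R := by
    have := ne_iff_sq_pos.1 (hV.isResidual hp₀).1.ne
    linarith
  set O := V.filter fun p => p + partner V p = c + c ∧
    (p 0 - c 0) ^ 2 + (p 1 - c 1) ^ 2 = R with hO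
  have hmemO : ∀ p, p ∈ O ↔ p ∈ V ∧ p + partner V p = c + c ∧
    (p 0 - c 0) ^ 2 + (p 1 - c 1) ^ 2 = R := fun p => by rw [hO, Finset.mem_filter]
  -- The map goes to the next vertex of the rectangle on `p` and its partner. Its image is on the
  -- circle by Thales.
  have hmap : Set.MapsTo (fun p => leftNbr V (partner V p)) O O := by
    intro p hp
    obtain ⟨hpV, hpc, hpR⟩ := (hmemO p).1 hp
    have hu := hV.partner_mem hpV
    refine (hmemO _).2 ⟨hV.leftNbr_mem hu, ?_, ?_⟩
    · rw [hV.partner_leftNbr hu, hV.partner_partner hpV, add_comm,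
        (hV.isResidual hpV).rectangle.1, hpc]
    · obtain ⟨e, h⟩ := (hV.isResidual hpV).rectangle
      rw [hpc] at e
      have e0 := congrArg (· 0) e
      have e1 := congrArg (· 1) e
      simp only [PiLp.add_apply] at e0 e1
      rw [show leftNbr V p 0 = c 0 + c 0 - leftNbr V (partner V p) 0 by linarith,
        show leftNbr V p 1 = c 1 + c 1 - leftNbr V (partner V p) 1 by linarith] at h
      rw [← hpR]
      linear_combination -h
  have hinj : Set.InjOn (fun p => leftNbr V (partner V p)) O := by
    intro p hp q hq h
    have hp := ((hmemO p).1 hp).1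
    have hq := ((hmemO q).1 hq).1
    have := hV.injOn_leftNbr (hV.partner_mem hp) (hV.partner_mem hq) h
    rw [← hV.partner_partner hp, this, hV.partner_partner hq]
  have hdisc : ∀ z, (∀ p q, IsDoubleNormal V p q → z ∈ closedStrip p q) →
      (z 0 - c 0) ^ 2 + (z 1 - c 1) ^ 2 ≤ R ∧
        ((z 0 - c 0) ^ 2 + (z 1 - c 1) ^ 2 = R → z ∈ O) := by
    intro z hz
    have key : ∀ p ∈ O, 0 < cross (p - c) (leftNbr V (partner V p) - c) ∧
        0 ≤ cross (leftNbr V (partner V p) - p) (z - p) := by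
      intro p hp
      obtain ⟨hpV, hpc, hpR⟩ := (hmemO p).1 hp
      obtain ⟨e, h1⟩ := (hV.isResidual hpV).rectangle
      have h2 := (mem_closedStrip.1 (hz _ _ (hV.isDoubleNormal_leftNbr hpV))).1
      have h3 := (hV.isResidual hpV).cross_pos
      have h4 := ne_iff_sq_pos.1 (hV.isDoubleNormal_leftNbr hpV).ne
      have e0 := congrArg (· 0) e
      have e1 := congrArg (· 1) e
      have f0 := congrArg (· 0) hpc
      have f1 := congrArg (· 1) hpc
      simp only [PiLp.add_apply] at e0 e1 f0 f1
      rw [cross_sub] at h3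
      rw [cross_sub, cross_sub]
      generalize leftNbr V (partner V p) = r at *
      generalize leftNbr V p = q at *
      generalize partner V p = u at *
      have e0 : u 0 = q 0 + r 0 - p 0 := by linarith
      have e1 : u 1 = q 1 + r 1 - p 1 := by linarith
      have f0 : c 0 = (q 0 + r 0) / 2 := by linarith
      have f1 : c 1 = (q 1 + r 1) / 2 := by linarith
      rw [e0, e1] at h3
      constructor
      · rw [f0, f1]; linarith
      -- The side `pr` is perpendicular to `pq`, so the strip of `pq` lies to its left.
      · refine nonneg_of_mul_nonneg_right (a := (p 0 - q 0) ^ 2 + (p 1 - q 1) ^ 2) ?_ h4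
        have : ((p 0 - q 0) ^ 2 + (p 1 - q 1) ^ 2) *
            ((r 0 - p 0) * (z 1 - p 1) - (r 1 - p 1) * (z 0 - p 0)) =
            ((q 0 - p 0) * (z 1 - p 1) - (q 1 - p 1) * (z 0 - p 0)) *
              ((q 0 - p 0) * (r 0 - p 0) + (q 1 - p 1) * (r 1 - p 1)) +
            ((q 0 + r 0 - p 0 - p 0) * (q 1 - p 1) - (q 1 + r 1 - p 1 - p 1) * (q 0 - p 0)) *
              ((z 0 - p 0) * (q 0 - p 0) + (z 1 - p 1) * (q 1 - p 1)) := by ring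
        rw [this, h1, mul_zero, zero_add]
        exact mul_nonneg h3.le h2
    exact sq_le_of_left_of_sides ⟨p₀, (hmemO _).2 ⟨hp₀, hc, hRd.symm⟩⟩
      (Finset.surjOn_of_injOn_of_card_le _ hmap hinj le_rfl) hmap
      (fun p hp => ((hmemO p).1 hp).2.2) (fun p hp => (key p hp).1) (fun p hp => (key p hp).2)
  have hVdisc : ∀ v ∈ V, (v 0 - c 0) ^ 2 + (v 1 - c 1) ^ 2 ≤ R :=
    fun v hv => (hdisc v fun p q h => h.2.2.2 v hv).1
  have hVO : ∀ v ∈ V, v ∈ O := by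
    intro v hv
    have h1 := hVdisc v hv
    have h2 := hVdisc _ (hV.partner_mem hv)
    have h3 := hmin v hv
    simp only [hdiam] at h3
    refine (hdisc v fun p q h => h.2.2.2 v hv).2 (le_antisymm h1 ?_)
    -- Two points of the disc at distance at least its diameter lie on the circle.
    nlinarith [sq_nonneg (v 0 + partner V v 0 - 2 * c 0), sq_nonneg (v 1 + partner V v 1 - 2 * c 1)]
  refine ⟨c, R, hRpos, fun v hv => ((hmemO v).1 (hVO v hv)).2.2, fun v hv => ?_, fun z hz hzV => ?_⟩
  · rw [← ((hmemO v).1 (hVO v hv)).2.1, add_sub_cancel_left]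
    exact hV.partner_mem hv
  · exact lt_of_le_of_ne (hdisc z hz).1 fun h => hzV ((hmemO z).1 ((hdisc z hz).2 h)).1

end IsExtremal

end

/-! ### The upper bound and the equality case. -/

section

variable {V : Finset Plane}

lemma card_nonisolated_le : (nonisolated V).card ≤ V.card := Finset.card_le_card nonisolated_subset

lemma card_matched_le : (matched V).card ≤ V.card := Finset.card_le_card matched_subset

lemma two_mul_numDoubleNormals_le : 2 * numDoubleNormals V ≤ 3 * V.card := by
  classical
  have := card_pairs_add_le (V := V)
  have := card_nonisolated_le (V := V)
  have := card_matched_le (V := V)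
  omega

lemma isExtremal_of_le (h : 3 * V.card ≤ 2 * numDoubleNormals V) : IsExtremal V := by
  classical
  have h1 := card_pairs_add_le (V := V)
  have h2 := card_nonisolated_le (V := V)
  have h3 := card_matched_le (V := V)
  have h4 := Finset.eq_of_subset_of_card_le (matched_subset (V := V)) (by omega)
  have h5 := Finset.eq_of_subset_of_card_le (nonisolated_subset (V := V)) (by omega)
  refine ⟨fun p hp => by rwa [h4], fun p hp h => ?_⟩
  have : 0 < ((nonisolated V).filter fun p => leftNbr V (leftNbr V p) = p).card :=
    Finset.card_pos.2 ⟨p, Finset.mem_filter.2 ⟨by rwa [h5], h⟩⟩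
  omega

lemma IsDoubleNormal.mono {W : Finset Plane} {p q : Plane} (h : IsDoubleNormal V p q)
    (hW : W ⊆ V) (hp : p ∈ W) (hq : q ∈ W) : IsDoubleNormal W p q :=
  ⟨hp, hq, h.ne, fun x hx => h.2.2.2 x (hW hx)⟩

lemma sum_leftNbr_matched : ∑ p ∈ matched V, leftNbr V p = ∑ p ∈ matched V, p := by
  rw [← sub_eq_zero, ← Finset.sum_sub_distrib]
  refine Finset.sum_involution (fun p _ => partner V p) ?_ ?_ (fun p h => partner_mem h)
    (fun p h => partner_partner h)
  · intro p hp
    rw [sub_add_sub_comm, (isResidual_partner hp).rectangle.1, sub_self]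
  · exact fun p h _ => (isResidual_partner h).1.ne.symm

/-- If all points but one are matched, the unmatched point is not a leftmost neighbour of a
matched one. -/
lemma leftNbr_mem_matched_of_insert {z : Plane} (hz : z ∉ matched V)
    (hV : ∀ p ∈ V, p ≠ z → p ∈ matched V) (hzV : z ∈ V) {p : Plane} (hp : p ∈ matched V) :
    leftNbr V p ∈ matched V := by
  classical
  have hinj : Set.InjOn (leftNbr V) (matched V) := fun p hp q hq h =>
    (isResidual_partner hp).eq_of_leftNbr_eq (isResidual_partner hq) h
  have hVM : V = insert z (matched V) := by
    ext p
    rw [Finset.mem_insert]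
    constructor
    · exact fun h => or_iff_not_imp_left.2 (hV p h)
    · rintro (rfl | h)
      exacts [hzV, matched_subset h]
  set I := (matched V).image (leftNbr V) with hI
  have hIV : I ⊆ V := by
    intro q hq
    obtain ⟨p, hp, rfl⟩ := Finset.mem_image.1 hq
    exact (isResidual_partner hp).1.leftNbr.right_mem
  have hc : (V \ I).card = 1 := by
    rw [Finset.card_sdiff_of_subset hIV, hI, Finset.card_image_of_injOn hinj]
    have := congrArg Finset.card hVM
    rw [Finset.card_insert_of_notMem hz] at this
    omega
  obtain ⟨w, hw⟩ := Finset.card_eq_one.1 hc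
  have hs : ∑ p ∈ V \ I, p + ∑ p ∈ I, p = ∑ p ∈ V, p := Finset.sum_sdiff hIV
  have hs' : ∑ p ∈ V, p = z + ∑ p ∈ matched V, p := by
    conv_lhs => rw [hVM]
    exact Finset.sum_insert hz
  -- The rectangles make `leftNbr` preserve the sum of the matched points, so the single point `w`
  -- missed by `leftNbr` must be `z`.
  rw [hw, Finset.sum_singleton, hI, Finset.sum_image hinj, sum_leftNbr_matched, hs'] at hs
  have hwz : w = z := add_right_cancel hs
  have hpI : leftNbr V p ∈ I := Finset.mem_image_of_mem _ hp
  refine hV _ (hIV hpI) fun h => ?_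
  have : z ∈ V \ I := by rw [hw, hwz]; simp
  exact (Finset.mem_sdiff.1 this).2 (h ▸ hpI)

lemma numDoubleNormals_le_of_odd (h3 : 3 ≤ V.card) (hodd : Odd V.card) :
    numDoubleNormals V ≤ 3 * (V.card / 2) := by
  classical
  by_contra! hlt
  obtain ⟨m, hm⟩ := hodd
  obtain ⟨k, hk⟩ := even_card_matched (V := V)
  have h1 := card_pairs_add_le (V := V)
  have h2 := card_nonisolated_le (V := V)
  have h4 := card_matched_le (V := V)
  have h5 := Finset.eq_of_subset_of_card_le (nonisolated_subset (V := V)) (by omega)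
  have h6 : (V \ matched V).card = 1 := by
    rw [Finset.card_sdiff_of_subset matched_subset]; omega
  obtain ⟨z, hz⟩ := Finset.card_eq_one.1 h6
  have hz' : z ∈ V \ matched V := by rw [hz]; simp
  obtain ⟨hzV, hzM⟩ := Finset.mem_sdiff.1 hz'
  have hVM : ∀ p ∈ V, p ≠ z → p ∈ matched V := by
    intro p hp hpz
    by_contra hpM
    have : p ∈ V \ matched V := Finset.mem_sdiff.2 ⟨hp, hpM⟩
    rw [hz] at this
    exact hpz (Finset.mem_singleton.1 this)
  -- A second double normal at `z` would be leftmost at neither end, hence residual.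
  have huniq : ∀ q, IsDoubleNormal V z q → q = leftNbr V z := by
    intro q hq
    by_contra hne
    refine hzM (mem_matched.2 ⟨q, hq, Ne.symm hne, fun h => hzM ?_⟩)
    rw [← h]
    exact leftNbr_mem_matched_of_insert hzM hVM hzV (hVM q hq.right_mem hq.ne.symm)
  obtain ⟨q, hq⟩ := mem_nonisolated.1 (h5 ▸ hzV)
  have hsub : doubleNormalPairs V \ {(z, leftNbr V z), (leftNbr V z, z)} ⊆
      doubleNormalPairs (V.erase z) := by
    rintro ⟨a, b⟩ hab
    simp only [Finset.mem_sdiff, Finset.mem_insert, Finset.mem_singleton, Prod.mk.injEq,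
      not_or, mem_doubleNormalPairs] at hab ⊢
    obtain ⟨hab, n1, n2⟩ := hab
    refine hab.mono (Finset.erase_subset _ _) (Finset.mem_erase.2 ⟨?_, hab.left_mem⟩)
      (Finset.mem_erase.2 ⟨?_, hab.right_mem⟩)
    · rintro rfl
      exact n1 ⟨rfl, huniq b hab⟩
    · rintro rfl
      exact n2 ⟨huniq a hab.symm, rfl⟩
  have hcard : 2 * numDoubleNormals V ≤
      (doubleNormalPairs V \ {(z, leftNbr V z), (leftNbr V z, z)}).card + 2 := by
    rw [← card_doubleNormalPairs]
    have := Finset.le_card_sdiff {(z, leftNbr V z), (leftNbr V z, z)} (doubleNormalPairs V)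
    have : ({(z, leftNbr V z), (leftNbr V z, z)} : Finset (Plane × Plane)).card ≤ 2 :=
      Finset.card_le_two
    omega
  have hW := Finset.card_erase_of_mem hzV
  have hbd := two_mul_numDoubleNormals_le (V := V.erase z)
  -- At least `3(|V| - 1)` ordered pairs survive, the maximum for `V.erase z`. So the deletion
  -- creates no new double normals, and `z` is in all the strips of `V.erase z`.
  have heq := Finset.eq_of_subset_of_card_le hsub (by rw [card_doubleNormalPairs]; omega)
  have hle := Finset.card_le_card hsub
  rw [card_doubleNormalPairs] at hle
  have hext : IsExtremal (V.erase z) := isExtremal_of_le (by omega)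
  obtain ⟨c, R, -, hcirc, hsymm, hdisc⟩ := hext.exists_circle (Finset.card_pos.1 (by omega))
  have hzR := hdisc z (fun a b hab => by
    have := mem_doubleNormalPairs (x := (a, b)) |>.2 hab
    rw [← heq] at this
    exact (mem_doubleNormalPairs.1 (Finset.mem_sdiff.1 this).1).2.2.2 z hzV)
    (Finset.notMem_erase _ _)
  have hqW : q ∈ V.erase z := Finset.mem_erase.2 ⟨hq.ne.symm, hq.right_mem⟩
  have hqR := hcirc q hqW
  -- From `z`, strictly inside the circle, the diameter through `q` is seen at an obtuse angle.
  have := hq.dot_nonneg (Finset.mem_of_mem_erase (hsymm q hqW))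
  simp only [PiLp.sub_apply, PiLp.add_apply] at this
  linarith

theorem numDoubleNormals_le (h3 : 3 ≤ V.card) : numDoubleNormals V ≤ 3 * (V.card / 2) := by
  rcases Nat.even_or_odd V.card with h | h
  · have := two_mul_numDoubleNormals_le (V := V)
    obtain ⟨m, hm⟩ := h
    omega
  · exact numDoubleNormals_le_of_odd h3 h

theorem exists_sphere_of_eq (h3 : 3 ≤ V.card) (heven : Even V.card)
    (h : numDoubleNormals V = 3 * V.card / 2) :
    ∃ (c : Plane) (r : ℝ), 0 < r ∧ (V : Set Plane) ⊆ Metric.sphere c r ∧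
      Equiv.pointReflection c '' (V : Set Plane) = V := by
  obtain ⟨m, hm⟩ := heven
  have hext : IsExtremal V := isExtremal_of_le (by omega)
  obtain ⟨c, R, hR, hcirc, hsymm, -⟩ := hext.exists_circle (Finset.card_pos.1 (by omega))
  have hrefl : ∀ x, Equiv.pointReflection c x = c + c - x := by
    intro x
    rw [Equiv.pointReflection_apply, vsub_eq_sub, vadd_eq_add]; abel
  refine ⟨c, √R, Real.sqrt_pos.2 hR, fun v hv => ?_, ?_⟩
  · rw [Metric.mem_sphere, ← Real.sqrt_sq dist_nonneg, dist_sq, hcirc v hv]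
  · ext x
    simp only [Set.mem_image, Finset.mem_coe, hrefl]
    constructor
    · rintro ⟨y, hy, rfl⟩
      exact hsymm y hy
    · exact fun hx => ⟨_, hsymm x hx, by abel⟩

end

/-! ### Sharpness: regular polygons. -/

/-- The vertices of the regular `2m`-gon inscribed in the unit circle, indexed by the integers. -/
noncomputable def polygonVertex (m : ℕ) (k : ℤ) : Plane :=
  !₂[Real.cos (k * (Real.pi / m)), Real.sin (k * (Real.pi / m))]

section

variable {m : ℕ}

@[simp] lemma polygonVertex_zero (k : ℤ) :
    polygonVertex m k 0 = Real.cos (k * (Real.pi / m)) := rfl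

@[simp] lemma polygonVertex_one (k : ℤ) :
    polygonVertex m k 1 = Real.sin (k * (Real.pi / m)) := rfl

lemma polygonVertex_eq_iff (hm : 0 < m) {i j : ℤ} :
    polygonVertex m i = polygonVertex m j ↔ (2 * m : ℤ) ∣ i - j := by
  have hm' : (m : ℝ) ≠ 0 := by positivity
  have h1 : polygonVertex m i = polygonVertex m j ↔
      Real.cos (i * (Real.pi / m) - j * (Real.pi / m)) = 1 := by
    rw [Real.cos_sub]
    have e1 := Real.cos_sq_add_sin_sq (i * (Real.pi / m))
    have e2 := Real.cos_sq_add_sin_sq (j * (Real.pi / m))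
    constructor
    · intro h
      have h0 := congrArg (· 0) h
      have h1 := congrArg (· 1) h
      simp only [polygonVertex_zero, polygonVertex_one] at h0 h1
      rw [h0, h1]
      linarith
    · intro h
      by_contra hne
      have := ne_iff_sq_pos.1 hne
      simp only [polygonVertex_zero, polygonVertex_one] at this
      linarith
  rw [h1, Real.cos_eq_one_iff]
  constructor
  · rintro ⟨n, hn⟩
    refine ⟨n, ?_⟩
    have hpi := Real.pi_ne_zero
    field_simp at hn
    have : ((i - j : ℤ) : ℝ) = ((2 * m * n : ℤ) : ℝ) := by push_cast; linarith
    exact_mod_cast this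
  · rintro ⟨n, hn⟩
    refine ⟨n, ?_⟩
    have : ((i - j : ℤ) : ℝ) = ((2 * m * n : ℤ) : ℝ) := by rw [hn]
    push_cast at this
    rw [← sub_mul, this]
    field_simp

lemma sin_mul_sin_nonneg {t : ℝ} (ht : 0 < t) {l : ℤ} (h1 : -Real.pi ≤ (l - 1) * t)
    (h2 : l * t ≤ Real.pi) : 0 ≤ Real.sin (l * t) * Real.sin ((l - 1) * t) := by
  rcases le_or_gt l 0 with h | h
  · have h' : (l : ℝ) ≤ 0 := by exact_mod_cast h
    exact mul_nonneg_of_nonpos_of_nonpos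
      (Real.sin_nonpos_of_nonpos_of_neg_pi_le (by nlinarith) (by nlinarith))
      (Real.sin_nonpos_of_nonpos_of_neg_pi_le (by nlinarith) h1)
  · have h' : (1 : ℝ) ≤ l := by exact_mod_cast h
    exact mul_nonneg (Real.sin_nonneg_of_nonneg_of_le_pi (by nlinarith) h2)
      (Real.sin_nonneg_of_nonneg_of_le_pi (by nlinarith) (by nlinarith))

/-- Consecutive multiples of `π / (2m)` are never strictly separated by a multiple of `π`. -/
lemma sin_mul_sin_pred_nonneg (hm : 0 < m) (l : ℤ) :
    0 ≤ Real.sin (l * (Real.pi / (2 * m))) * Real.sin ((l - 1) * (Real.pi / (2 * m))) := by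
  have hm' : (0 : ℝ) < m := by exact_mod_cast hm
  have key : ∀ r : ℤ, 0 ≤ r → r < 2 * m →
      0 ≤ Real.sin (r * (Real.pi / (2 * m))) * Real.sin ((r - 1) * (Real.pi / (2 * m))) := by
    intro r h0 h1
    have h0' : (0 : ℝ) ≤ r := by exact_mod_cast h0
    have h1' : (r : ℝ) ≤ 2 * m := by exact_mod_cast h1.le
    have h2 : (1 : ℝ) ≤ 2 * m := by
      have : (1 : ℝ) ≤ m := by exact_mod_cast hm
      linarith
    have hpi := Real.pi_pos
    refine sin_mul_sin_nonneg (by positivity) ?_ ?_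
    · rw [mul_div_assoc', le_div_iff₀ (by positivity)]
      nlinarith
    · rw [mul_div_assoc', div_le_iff₀ (by positivity)]
      nlinarith
  have hr := key (l % (2 * m)) (Int.emod_nonneg _ (by omega)) (Int.emod_lt_of_pos _ (by omega))
  have hl : (l : ℝ) = (l % (2 * m) : ℤ) + (l / (2 * m) : ℤ) * (2 * m) := by
    have := Int.emod_add_mul_ediv l (2 * m)
    have : (l : ℝ) = ((l % (2 * m) + 2 * m * (l / (2 * m)) : ℤ) : ℝ) := by rw [this]
    push_cast at this
    linarith
  generalize l % (2 * m) = r at *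
  generalize l / (2 * (m : ℤ)) = n at *
  have e1 : (l : ℝ) * (Real.pi / (2 * m)) = r * (Real.pi / (2 * m)) + n * Real.pi := by
    rw [hl]; field_simp
  have e2 : ((l : ℝ) - 1) * (Real.pi / (2 * m)) = (r - 1) * (Real.pi / (2 * m)) + n * Real.pi := by
    rw [hl]; field_simp; ring
  rw [e1, e2, Real.sin_add_int_mul_pi, Real.sin_add_int_mul_pi]
  have : ((-1 : ℝ) ^ n) * ((-1 : ℝ) ^ n) = 1 := by
    rw [← mul_zpow]; norm_num
  rw [mul_mul_mul_comm, this, one_mul]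
  exact hr

/-- With `s = π / (2m)` this is `2 cos s cos((2l - 1)s) ≤ 2 cos² s`, and `cos s - cos((2l - 1)s)` is
twice the product of sines above. -/
lemma cos_add_cos_pred_le (hm : 0 < m) (l : ℤ) :
    Real.cos (l * (Real.pi / m)) + Real.cos ((l - 1) * (Real.pi / m)) ≤
      1 + Real.cos (Real.pi / m) := by
  have hm' : (1 : ℝ) ≤ m := by exact_mod_cast hm
  have h1 := sin_mul_sin_pred_nonneg hm l
  obtain ⟨s, hs⟩ : ∃ s, s = Real.pi / (2 * m) := ⟨_, rfl⟩
  have hs2 : Real.pi / m = 2 * s := by rw [hs]; field_simp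
  have h2 : 0 ≤ Real.cos s := by
    have hs0 : 0 ≤ s := by rw [hs]; have := Real.pi_pos; positivity
    refine Real.cos_nonneg_of_neg_pi_div_two_le_of_le (by linarith [Real.pi_pos]) ?_
    rw [hs, div_le_div_iff₀ (by positivity) (by positivity)]
    nlinarith [Real.pi_pos]
  rw [← hs] at h1
  rw [hs2]
  have e1 : (l : ℝ) * (2 * s) = (l * s + (l - 1) * s) + s := by ring
  have e2 : ((l : ℝ) - 1) * (2 * s) = (l * s + (l - 1) * s) - s := by ring
  have e3 : Real.cos s = Real.cos (l * s - (l - 1) * s) := by congr 1; ring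
  have e4 : 1 + Real.cos (2 * s) = 2 * Real.cos s * Real.cos s := by rw [Real.cos_two_mul]; ring
  have e5 : Real.cos (l * s + (l - 1) * s) ≤ Real.cos s := by
    rw [e3, Real.cos_add, Real.cos_sub]; linarith
  rw [e4, e1, e2, Real.cos_add _ s, Real.cos_sub _ s]
  have := mul_le_mul_of_nonneg_left e5 h2
  linarith

/-- With `t = π / m`, the expression equals `1 + cos(et) - cos((j - i)t) - cos((j - i - e)t)`. -/
lemma polygonVertex_dot_nonneg (hm : 0 < m) (i j e : ℤ) (he : e = 0 ∨ e = 1 ∨ e = -1) :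
    0 ≤ (polygonVertex m j 0 - polygonVertex m i 0) *
        (polygonVertex m (i + m + e) 0 - polygonVertex m i 0) +
      (polygonVertex m j 1 - polygonVertex m i 1) *
        (polygonVertex m (i + m + e) 1 - polygonVertex m i 1) := by
  have hm' : (m : ℝ) ≠ 0 := by positivity
  simp only [polygonVertex_zero, polygonVertex_one]
  obtain ⟨t, ht⟩ : ∃ t, t = Real.pi / m := ⟨_, rfl⟩
  have hmt : m * t = Real.pi := by rw [ht]; field_simp
  have key : Real.cos ((j - i : ℤ) * t) + Real.cos (((j - i : ℤ) - e) * t) ≤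
      1 + Real.cos (e * t) := by
    rcases he with rfl | rfl | rfl
    · have := Real.cos_le_one ((j - i : ℤ) * t)
      simp only [Int.cast_zero, sub_zero, zero_mul, Real.cos_zero]
      linarith
    · have := cos_add_cos_pred_le hm (j - i)
      rw [← ht] at this
      simpa using this
    · have := cos_add_cos_pred_le hm (j - i + 1)
      rw [← ht] at this
      push_cast at this ⊢
      simp only [add_sub_cancel_right, neg_mul, one_mul, Real.cos_neg, sub_neg_eq_add] at this ⊢
      linarith
  rw [← ht]
  have e1 : ((i + m + e : ℤ) : ℝ) * t = (i * t + e * t) + Real.pi := by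
    push_cast; linear_combination hmt
  rw [e1, Real.cos_add_pi, Real.sin_add_pi]
  have e2 : ((j - i : ℤ) : ℝ) * t = j * t - i * t := by push_cast; ring
  have e3 : (((j - i : ℤ) : ℝ) - e) * t = j * t - (i * t + e * t) := by push_cast; ring
  have e4 : (e : ℝ) * t = (i * t + e * t) - i * t := by ring
  rw [e2, e3, e4, Real.cos_sub, Real.cos_sub, Real.cos_sub] at key
  rw [← e4] at key
  have e5 := Real.cos_sq_add_sin_sq (i * t)
  linarith

lemma polygonVertex_mem_closedStrip (hm : 0 < m) (i j e : ℤ) (he : e = 0 ∨ e = 1 ∨ e = -1) :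
    polygonVertex m j ∈ closedStrip (polygonVertex m i) (polygonVertex m (i + m + e)) := by
  refine mem_closedStrip.2 ⟨polygonVertex_dot_nonneg hm i j e he, ?_⟩
  have h := polygonVertex_dot_nonneg hm (i + m + e) j (-e) (by omega)
  rwa [show polygonVertex m (i + m + e + m + -e) = polygonVertex m i from
    (polygonVertex_eq_iff hm).2 ⟨1, by ring⟩] at h

lemma zero_mem_closedStrip_polygonVertex (i k : ℤ) :
    (0 : Plane) ∈ closedStrip (polygonVertex m i) (polygonVertex m k) := by
  rw [mem_closedStrip]
  simp only [polygonVertex_zero, polygonVertex_one, PiLp.zero_apply]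
  have h1 := Real.cos_sq_add_sin_sq (i * (Real.pi / m))
  have h2 := Real.cos_sq_add_sin_sq (k * (Real.pi / m))
  constructor <;>
  nlinarith [sq_nonneg (Real.cos (i * (Real.pi / m)) - Real.cos (k * (Real.pi / m))),
    sq_nonneg (Real.sin (i * (Real.pi / m)) - Real.sin (k * (Real.pi / m)))]

open Classical in
/-- The vertex set of the regular `2m`-gon. -/
noncomputable def polygon (m : ℕ) : Finset Plane :=
  (Finset.range (2 * m)).image fun k : ℕ => polygonVertex m k

lemma polygonVertex_injOn (hm : 0 < m) :
    Set.InjOn (fun k : ℕ => polygonVertex m k) (Finset.range (2 * m)) := by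
  intro i hi j hj h
  simp only [Finset.coe_range, Set.mem_Iio] at hi hj
  have := Int.eq_zero_of_abs_lt_dvd ((polygonVertex_eq_iff hm).1 h) (by rw [abs_lt]; omega)
  omega

lemma card_polygon (hm : 0 < m) : (polygon m).card = 2 * m := by
  rw [polygon, Finset.card_image_of_injOn (polygonVertex_injOn hm), Finset.card_range]

lemma polygonVertex_mem_polygon (hm : 0 < m) (k : ℤ) : polygonVertex m k ∈ polygon m := by
  have h0 : 0 ≤ k % (2 * m) := Int.emod_nonneg _ (by omega)
  have h1 : k % (2 * m) < 2 * m := Int.emod_lt_of_pos _ (by omega)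
  refine Finset.mem_image.2 ⟨(k % (2 * m)).toNat, Finset.mem_range.2 (by omega), ?_⟩
  refine (polygonVertex_eq_iff hm).2 ?_
  rw [Int.toNat_of_nonneg h0]
  exact ⟨-(k / (2 * m)), by have := Int.emod_add_mul_ediv k (2 * m); linarith⟩

/-- A set containing the regular `2m`-gon and contained in all of the strips of its double normals
has at least `3m` double normals. -/
lemma le_numDoubleNormals_of_polygon_subset (hm : 2 ≤ m) {V : Finset Plane} (hV : polygon m ⊆ V)
    (hstrip : ∀ x ∈ V, ∀ i e : ℤ, (e = 0 ∨ e = 1 ∨ e = -1) →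
      x ∈ closedStrip (polygonVertex m i) (polygonVertex m (i + m + e))) :
    3 * m ≤ numDoubleNormals V := by
  have hm0 : 0 < m := by omega
  suffices h : (Finset.range (2 * m) ×ˢ ({0, 1, -1} : Finset ℤ)).card ≤
      (doubleNormalPairs V).card by
    rw [card_doubleNormalPairs, Finset.card_product, Finset.card_range] at h
    have : ({0, 1, -1} : Finset ℤ).card = 3 := rfl
    rw [this] at h
    omega
  refine Finset.card_le_card_of_injOn
    (fun x => (polygonVertex m x.1, polygonVertex m (x.1 + m + x.2))) ?_ ?_
  · rintro ⟨i, e⟩ hx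
    simp only [Finset.coe_product, Set.mem_prod, Finset.mem_coe, Finset.mem_insert,
      Finset.mem_singleton] at hx
    refine mem_doubleNormalPairs.2 ⟨hV (polygonVertex_mem_polygon hm0 _),
      hV (polygonVertex_mem_polygon hm0 _), fun h => ?_, fun x hxV => hstrip x hxV i e hx.2⟩
    -- Here `2 ≤ m` gives `0 < m + e < 2m`.
    have := Int.eq_zero_of_abs_lt_dvd ((polygonVertex_eq_iff hm0).1 h) (by rw [abs_lt]; omega)
    omega
  · rintro ⟨i, e⟩ hx ⟨j, f⟩ hy h
    simp only [Finset.coe_product, Set.mem_prod, Finset.mem_coe, Finset.mem_insert,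
      Finset.mem_singleton] at hx hy
    obtain ⟨h1, h2⟩ := Prod.mk.inj h
    obtain rfl : i = j := polygonVertex_injOn hm0 (by simpa using hx.1) (by simpa using hy.1) h1
    have := Int.eq_zero_of_abs_lt_dvd ((polygonVertex_eq_iff hm0).1 h2) (by rw [abs_lt]; omega)
    exact Prod.ext rfl (by simp only at this ⊢; omega)

lemma three_le_numDoubleNormals_triangle {V : Finset Plane} (h : V.card = 3)
    (hV : ∀ a ∈ V, ∀ b ∈ V, ∀ x ∈ V, x ∈ closedStrip a b) : 3 ≤ numDoubleNormals V := by
  classical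
  have h1 : V.offDiag ⊆ doubleNormalPairs V := by
    rintro ⟨a, b⟩ hab
    obtain ⟨ha, hb, hne⟩ := Finset.mem_offDiag.1 hab
    exact mem_doubleNormalPairs.2 ⟨ha, hb, hne, hV a ha b hb⟩
  have := Finset.card_le_card h1
  rw [Finset.offDiag_card, h, card_doubleNormalPairs] at this
  omega

theorem exists_numDoubleNormals_eq {n : ℕ} (hn : 3 ≤ n) :
    ∃ V : Finset Plane, V.card = n ∧ numDoubleNormals V = 3 * (n / 2) := by
  classical
  suffices h : ∃ V : Finset Plane, V.card = n ∧ 3 * (n / 2) ≤ numDoubleNormals V by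
    obtain ⟨V, hc, hle⟩ := h
    refine ⟨V, hc, le_antisymm ?_ hle⟩
    have := numDoubleNormals_le (V := V) (by omega)
    rwa [hc] at this
  have hpoly : ∀ m : ℕ, 0 < m → ∀ x ∈ polygon m, ∀ i e : ℤ, (e = 0 ∨ e = 1 ∨ e = -1) →
      x ∈ closedStrip (polygonVertex m i) (polygonVertex m (i + m + e)) := by
    intro m hm x hx i e he
    obtain ⟨j, -, rfl⟩ := Finset.mem_image.1 hx
    exact polygonVertex_mem_closedStrip hm i j e he
  rcases Nat.even_or_odd n with ⟨m, hm⟩ | ⟨m, hm⟩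
  · refine ⟨polygon m, by rw [card_polygon (by omega)]; omega, ?_⟩
    have := le_numDoubleNormals_of_polygon_subset (by omega) subset_rfl (hpoly m (by omega))
    omega
  -- For `m = 1` the polygon degenerates to two points, so a right triangle is used.
  rcases eq_or_ne m 1 with rfl | hm1
  · have hc : ({!₂[0, 0], !₂[1, 0], !₂[0, 1]} : Finset Plane).card = 3 := by
      rw [Finset.card_eq_three]
      refine ⟨_, _, _, ?_, ?_, ?_, rfl⟩ <;> simp
    refine ⟨_, hc.trans (by omega), ?_⟩
    have := three_le_numDoubleNormals_triangle hc (by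
      intro a ha b hb x hx
      rw [mem_closedStrip]
      simp only [Finset.mem_insert, Finset.mem_singleton] at ha hb hx
      rcases ha with rfl | rfl | rfl <;> rcases hb with rfl | rfl | rfl <;>
        rcases hx with rfl | rfl | rfl <;> simp)
    omega
  · have h0 : (0 : Plane) ∉ polygon m := by
      intro h
      obtain ⟨j, -, hj⟩ := Finset.mem_image.1 h
      have h0 := congrArg (· 0) hj
      have h1 := congrArg (· 1) hj
      simp only [polygonVertex_zero, polygonVertex_one, PiLp.zero_apply] at h0 h1
      have := Real.cos_sq_add_sin_sq ((j : ℤ) * (Real.pi / m))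
      rw [h0, h1] at this
      norm_num at this
    refine ⟨insert 0 (polygon m), ?_, ?_⟩
    · rw [Finset.card_insert_of_notMem h0, card_polygon (by omega)]; omega
    · have := le_numDoubleNormals_of_polygon_subset (m := m) (by omega)
        (Finset.subset_insert 0 _) (by
          intro x hx i e he
          rcases Finset.mem_insert.1 hx with rfl | hx
          · exact zero_mem_closedStrip_polygonVertex _ _
          · exact hpoly m (by omega) x hx i e he)
      omega

end

theorem theorem1 :
    (∀ V : Finset (EuclideanSpace ℝ (Fin 2)), 3 ≤ V.card →
      numDoubleNormals V ≤ 3 * (V.card / 2)) ∧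
    (∀ n : ℕ, 3 ≤ n → ∃ V : Finset (EuclideanSpace ℝ (Fin 2)),
      V.card = n ∧ numDoubleNormals V = 3 * (n / 2)) ∧
    (∀ V : Finset (EuclideanSpace ℝ (Fin 2)), 3 ≤ V.card → Even V.card →
      numDoubleNormals V = 3 * V.card / 2 →
      ∃ (c : EuclideanSpace ℝ (Fin 2)) (r : ℝ), 0 < r ∧
        (V : Set (EuclideanSpace ℝ (Fin 2))) ⊆ Metric.sphere c r ∧
        Equiv.pointReflection c '' (V : Set (EuclideanSpace ℝ (Fin 2))) = V) :=
  ⟨fun _ h => numDoubleNormals_le h, fun _ h => exists_numDoubleNormals_eq h,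
    fun _ h3 he h => exists_sphere_of_eq h3 he h⟩
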